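/- Let $n \ge 0$, $\ell \ge 1$, $q \ge 0$ be integers and let $\alpha,\gamma \ge 0$ be reals with $\alpha + \gamma \le 1$. Write $\mathcal F_n$ for the family of all functions $\{0,1\}^n \to \{0,1\}^n$. A *two-message, non-adaptive oracle protocol* $\Pi=(\mathsf A,\mathsf B)$ relative to $\mathcal F_n$ works as follows. The parties draw independent private random coins $r_{\mathsf A}$, $r_{\mathsf B}$. Each party determines from its own coins alone a list of oracle queries in $\{0,1\}^n$, and receives the answers of the oracle $f\in\mathcal F_n$ to these queries. Then $\mathsf A$ sends a message $m_1$ (a bit string, a function of her coins and answers); $\mathsf B$ replies with a message $m_2$ (a bit string, a function of his coins, his answers and $m_1$); finally each party outputs a bit, $\mathrm{out}^{\mathsf A}$ respectively $\mathrm{out}^{\mathsf B}$, which is a function of its own coins, its own answers and the messages. The parties are computationally unbounded. The protocol is *$\ell$-query* if each party asks at most $\ell$ queries in every run. The *communication complexity* $\mathrm{CC}(\Pi)$ is the maximal total length $|m_1|+|m_2|$ of the transcript $(m_1,m_2)$ over all oracles and all possible coins ($\infty$ if unbounded). The protocol is a *$(q,\alpha,\gamma)$-key agreement relative to $\mathcal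 F_n$* if * (accuracy) for every $f \in \mathcal F_n$, in a random execution with oracle $f$, $\Pr[\mathrm{out}^{\mathsf A}=\mathrm{out}^{\mathsf B}] \ge 1-\alpha$; and * (secrecy) for every (randomized, adaptive, computationally unbounded) algorithm $\mathsf E$ that asks at most $q$ oracle queries, when $f$ is uniform in $\mathcal F_n$ and $\Pi$ is executed with oracle $f$, $\Pr[\mathsf E^f(m_1,m_2) = \mathrm{out}^{\mathsf A}] \le \gamma$. **Theorem.** If $\Pi$ is a two-message, non-adaptive, $\ell$-query $(q,\alpha,\gamma)$-key-agreement protocol relative to $\mathcal F_n$, then $$\mathrm{CC}(\Pi) \;\ge\; \frac{(1-\alpha-\gamma)^2\, q}{50^2\,\ell} - 6 .$$ -/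

import Mathlib

/-- Bit strings of length `n`. -/
abbrev Bits (n : ℕ) : Type := Fin n → Bool

/-- The probability of the event `S` under the discrete distribution `p`. -/
noncomputable def prob {Ω : Type} (p : PMF Ω) (S : Set Ω) : ℝ :=
  (p.toOuterMeasure S).toReal

/-- A (deterministic, adaptive, computationally unbounded) oracle-aided algorithm with oracle
`D → R` and output in `O`, as a decision tree: it either stops with an output, or asks a query and
continues depending on the answer. -/
inductive OracleAlg (D R O : Type) : Type where
  | output (o : O) : OracleAlg D R O
  | query (d : D) (next : R → OracleAlg D R O) : OracleAlg D R O

/-- The output of the algorithm when it is run with oracle `f`. -/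
def OracleAlg.run {D R O : Type} (f : D → R) : OracleAlg D R O → O
  | .output o => o
  | .query d next => (next (f d)).run f

/-- The algorithm asks at most `q` queries, whatever the answers are. -/
def OracleAlg.QueriesAtMost {D R O : Type} : OracleAlg D R O → ℕ → Prop
  | .output _, _ => True
  | .query _ _, 0 => False
  | .query _ next, q + 1 => ∀ r : R, (next r).QueriesAtMost q

/-- A two-message, non-adaptive, oracle-aided protocol with boolean outputs between parties `A` and
`B`, relative to oracles `{0,1}^n → {0,1}^n`. Each party draws private random coins, which alone
determine its list of oracle queries; it then receives the list of the answers to these queries.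
First `A` sends a message to `B`, then `B` sends a message to `A`, and both give an output.
Messages are bit strings of arbitrary length. Each message and each output is a function of the
view of the party concerned: its coins, its answers and the message it has received. -/
structure TwoMessageProtocol (n : ℕ) where
  /-- The sample spaces and the distributions of the private coins. -/
  CoinsA : Type
  CoinsB : Type
  coinsA : PMF CoinsA
  coinsB : PMF CoinsB
  /-- The oracle queries of the parties. -/
  queriesA : CoinsA → List (Bits n)
  queriesB : CoinsB → List (Bits n)
  /-- The first message, from coins and answers of `A`. -/
  msgA : CoinsA → List (Bits n) → List Bool
  /-- The second message, from coins and answers of `B` and the first message. -/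
  msgB : CoinsB → List (Bits n) → List Bool → List Bool
  /-- The output of `A`, from her coins and answers and the second message. -/
  outputA : CoinsA → List (Bits n) → List Bool → Bool
  /-- The output of `B`, from his coins and answers and the first message. -/
  outputB : CoinsB → List (Bits n) → List Bool → Bool

namespace TwoMessageProtocol

variable {n : ℕ} (P : TwoMessageProtocol n)

/-- For a fixed oracle, an execution is determined by the coins of the two parties. -/
abbrev Coins : Type := P.CoinsA × P.CoinsB

/-- The coins of the two parties are independent. -/
noncomputable def coins : PMF P.Coins :=
  P.coinsA.bind fun a => P.coinsB.map fun b => (a, b)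

/-- The first message of the execution with oracle `f` and coins `v`. -/
def message₁ (f : Bits n → Bits n) (v : P.Coins) : List Bool :=
  P.msgA v.1 ((P.queriesA v.1).map f)

/-- The second message. -/
def message₂ (f : Bits n → Bits n) (v : P.Coins) : List Bool :=
  P.msgB v.2 ((P.queriesB v.2).map f) (P.message₁ f v)

/-- The transcript: the two messages. -/
def trans (f : Bits n → Bits n) (v : P.Coins) : List Bool × List Bool :=
  (P.message₁ f v, P.message₂ f v)

/-- The output of `A`. -/
def outA (f : Bits n → Bits n) (v : P.Coins) : Bool :=
  P.outputA v.1 ((P.queriesA v.1).map f) (P.message₂ f v)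

/-- The output of `B`. -/
def outB (f : Bits n → Bits n) (v : P.Coins) : Bool :=
  P.outputB v.2 ((P.queriesB v.2).map f) (P.message₁ f v)

/-- Each party asks at most `l` queries in each run. -/
def IsQueryBounded (l : ℕ) : Prop :=
  (∀ a ∈ P.coinsA.support, (P.queriesA a).length ≤ l) ∧
    ∀ b ∈ P.coinsB.support, (P.queriesB b).length ≤ l

/-- The communication complexity: the worst-case length of the transcript, over all oracles and
all possible coins (`⊤` if it is unbounded). -/
noncomputable def commComplexity : ℕ∞ :=
  ⨆ (f : Bits n → Bits n) (v ∈ P.coins.support),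
    (((P.message₁ f v).length + (P.message₂ f v).length : ℕ) : ℕ∞)

/-- Accuracy `1 - α`: for every oracle, the parties agree with probability at least `1 - α`. -/
def IsAccurate (α : ℝ) : Prop :=
  ∀ f : Bits n → Bits n, 1 - α ≤ prob P.coins {v | P.outA f v = P.outB f v}

/-- A randomized oracle-aided eavesdropper: given a transcript, it draws an oracle-aided algorithm
with boolean output, which is then run. -/
abbrev Eavesdropper (n : ℕ) : Type :=
  List Bool × List Bool → PMF (OracleAlg (Bits n) (Bits n) Bool)

/-- The joint distribution of the eavesdropper's guess and the output of `A`, for a uniformly random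
oracle `f` among all functions `{0,1}^n → {0,1}^n` and an independent random execution. -/
noncomputable def guessExperiment (E : Eavesdropper n) : PMF (Bool × Bool) :=
  (PMF.uniformOfFintype (Bits n → Bits n)).bind fun f =>
    P.coins.bind fun v =>
      (E (P.trans f v)).map fun e => (e.run f, P.outA f v)

/-- `(q, γ)`-secrecy: no eavesdropper that asks at most `q` oracle queries guesses the output of `A`
with probability more than `γ`. -/
def IsSecret (q : ℕ) (γ : ℝ) : Prop :=
  ∀ E : Eavesdropper n, (∀ t, ∀ e ∈ (E t).support, e.QueriesAtMost q) →
    prob (P.guessExperiment E) {p | p.1 = p.2} ≤ γ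

/-- `(q, α, γ)`-key agreement relative to the family of all functions `{0,1}^n → {0,1}^n`. -/
def IsKeyAgreement (q : ℕ) (α γ : ℝ) : Prop :=
  P.IsAccurate α ∧ P.IsSecret q γ

end TwoMessageProtocol

/-! The eavesdropper asks two sets of queries. `H` consists of the queries that `B` asks with
probability more than `δ`; `Q` consists of those that `A` asks with conditional probability more
than `δ` given `m₁` and the oracle on `H`. With at most `ℓ` queries per party, each set has at most
`ℓ/δ` elements, so `δ = 2ℓ/q` fits the budget `q`. The guess is the likelier output of `A` given the
messages and the answers on `H ∪ Q`.

The analytic core is `sum_expect_test_le`: a message with at most `exp L` values is almost useless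
for predicting the oracle on a random set that hits each coordinate with probability at most `δ`, up
to an error `2√(δL)`. For a fixed message value, Finner's inequality bounds an exponential moment of
the average test, since no coordinate is used too often; a sum over the message values and Jensen's
inequality finish.

This is used twice in `sum_expect_le_sum_expect_decoupled`. The message of `A` says little about the
answers of `B` off `H`, and the reply of `B` says little about the answers of `A` off `H ∪ Q`.
Hence, at cost `4√(δL)`, the reply may be computed from an oracle resampled off `H ∪ Q`. In that
experiment the view of `B` is independent of that of `A` given what the eavesdropper knows, so the
output bit of `B` cannot match that of `A` better than the likelier value does. Passing to this
experiment and back costs `8√(δL)` in all, and transcripts of length at most `c` allow `L = 2c + 1`.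
Accuracy and secrecy then give `1 - α - γ ≤ 8√(2ℓ(2c + 1)/q)`. -/

open Finset
open scoped BigOperators

/-! ### Resampling a random function, and Finner's inequality -/

section Resampling

variable {D R : Type*} [Fintype D] [DecidableEq D] [Fintype R]

/-- Exchanging two functions off a set that is determined by the first one does not change
averages over pairs of functions. -/
theorem expect_resample (V : (D → R) → Finset D)
    (hV : ∀ f g, V ((V f).piecewise f g) = V f) (K : (D → R) → (D → R) → ℝ) :
    𝔼 f, 𝔼 g, K ((V f).piecewise f g) ((V f).piecewise g f) = 𝔼 f, 𝔼 g, K f g := by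
  -- The swap keeps the values of `f` on `V f`, hence keeps `V f` itself, so a second swap undoes
  -- it.
  have key : Function.Involutive fun p : (D → R) × (D → R) =>
      ((V p.1).piecewise p.1 p.2, (V p.1).piecewise p.2 p.1) := by
    rintro ⟨f, g⟩
    refine Prod.ext ?_ ?_ <;> funext x <;> simp only [Finset.piecewise, hV] <;>
      by_cases hx : x ∈ V f <;> simp [hx]
  have := Fintype.expect_equiv key.toPerm
    (fun p => K ((V p.1).piecewise p.1 p.2) ((V p.1).piecewise p.2 p.1))
    (fun p => K p.1 p.2) (fun p => rfl)
  rw [← Finset.univ_product_univ, Finset.expect_product, Finset.expect_product] at this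
  exact this

theorem expect_resample_left [Nonempty R] (V : (D → R) → Finset D)
    (hV : ∀ f g, V ((V f).piecewise f g) = V f) (K : (D → R) → ℝ) :
    𝔼 f, 𝔼 g, K ((V f).piecewise f g) = 𝔼 f, K f := by
  rw [expect_resample V hV (fun f _ => K f)]
  simp

theorem expect_piecewise [Nonempty R] (S : Finset D) (K : (D → R) → ℝ) :
    𝔼 f, 𝔼 g, K (S.piecewise f g) = 𝔼 f, K f :=
  expect_resample_left (fun _ => S) (fun _ _ => rfl) K

/-- Hölder's inequality for exponents of total at most 1: once each factor is normalised to mean 1,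
it is weighted AM-GM pointwise, that is, convexity of `exp`. -/
theorem expect_exp_sum_le {Ω ι : Type*} [Fintype Ω] [Nonempty Ω] (s : Finset ι) (θ : ι → ℝ)
    (hθ : ∀ a ∈ s, 0 ≤ θ a) (hs : ∑ a ∈ s, θ a ≤ 1) (u : ι → Ω → ℝ) :
    𝔼 ω, Real.exp (∑ a ∈ s, θ a * u a ω) ≤
      Real.exp (∑ a ∈ s, θ a * Real.log (𝔼 ω, Real.exp (u a ω))) := by
  set c : ι → ℝ := fun a => Real.log (𝔼 ω, Real.exp (u a ω)) with hc
  have hexp : ∀ a, Real.exp (c a) = 𝔼 ω, Real.exp (u a ω) := fun a =>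
    Real.exp_log (Finset.expect_pos (fun _ _ => Real.exp_pos _) univ_nonempty)
  have hpt : ∀ v : ι → ℝ, Real.exp (∑ a ∈ s, θ a * v a) ≤
      ∑ a ∈ s, θ a * Real.exp (v a) + (1 - ∑ a ∈ s, θ a) := by
    intro v
    -- The extra index `none`, at the point 0, carries the missing weight.
    have h := convexOn_exp.map_sum_le (t := insertNone s)
      (w := fun o => o.elim (1 - ∑ a ∈ s, θ a) θ) (p := fun o => o.elim 0 v)
      (by
        intro o ho
        cases o with
        | none => simpa using hs
        | some a => exact hθ a (by simpa using ho))
      (by simp [sum_insertNone]) (by simp)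
    simp only [sum_insertNone, Option.elim, smul_eq_mul, mul_zero, zero_add, Real.exp_zero,
      mul_one] at h
    linarith
  have hle : 𝔼 ω, Real.exp (∑ a ∈ s, θ a * (u a ω - c a)) ≤ 1 := by
    calc 𝔼 ω, Real.exp (∑ a ∈ s, θ a * (u a ω - c a))
        ≤ 𝔼 ω, (∑ a ∈ s, θ a * Real.exp (u a ω - c a) + (1 - ∑ a ∈ s, θ a)) :=
          expect_le_expect fun ω _ => hpt _
      _ = 1 := by
          rw [expect_add_distrib, expect_sum_comm, expect_const univ_nonempty]
          have : ∀ a ∈ s, 𝔼 ω, θ a * Real.exp (u a ω - c a) = θ a := by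
            intro a _
            simp only [Real.exp_sub, ← mul_expect, ← expect_div, hexp]
            rw [div_self, mul_one]
            rw [← hexp]; exact (Real.exp_pos _).ne'
          rw [sum_congr rfl this]; ring
  have hfac : ∀ ω, Real.exp (∑ a ∈ s, θ a * u a ω) =
      Real.exp (∑ a ∈ s, θ a * (u a ω - c a)) * Real.exp (∑ a ∈ s, θ a * c a) := by
    intro ω
    rw [← Real.exp_add, ← sum_add_distrib]
    congr 1
    exact sum_congr rfl fun a _ => by ring
  simp only [hfac, ← expect_mul]
  exact mul_le_of_le_one_left (Real.exp_pos _).le hle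

/-- Finner's inequality, in logarithmic form: a product of powers of functions of few coordinates
each. -/
theorem expect_exp_sum_piecewise_le [Nonempty R] {ι : Type*} [Fintype ι] (θ : ι → ℝ)
    (hθ : ∀ a, 0 ≤ θ a) (Z : ι → Finset D) (u : ι → (D → R) → ℝ)
    (hu : ∀ a, DependsOn (u a) (Z a : Set D)) (T : Finset D)
    (hT : ∀ x ∈ T, ∑ a with x ∈ Z a, θ a ≤ 1) (f : D → R) :
    𝔼 g, Real.exp (∑ a, θ a * u a (T.piecewise g f)) ≤
      Real.exp (∑ a, θ a * Real.log (𝔼 g, Real.exp (u a (T.piecewise g f)))) := by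
  induction T using Finset.induction_on generalizing f with
  | empty => simp
  | insert x T hx ih =>
    have hpw : ∀ g g' : D → R, T.piecewise g (({x} : Finset D).piecewise g' f) =
        (insert x T).piecewise (T.piecewise g g') f := by
      intro g g'
      funext y
      by_cases hy : y ∈ T
      · simp [hy]
      · by_cases hyx : y = x
        · subst hyx; simp [hy]
        · simp [hy, hyx]
    have hsplit : ∀ K : (D → R) → ℝ,
        𝔼 g', 𝔼 g, K (T.piecewise g (({x} : Finset D).piecewise g' f)) =
          𝔼 g, K ((insert x T).piecewise g f) := by
      intro K
      simp only [hpw]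
      rw [expect_comm]
      exact expect_piecewise T fun g => K ((insert x T).piecewise g f)
    -- The coordinates in `T` are averaged out by induction. Only the `U a` with `x ∈ Z a` still
    -- depend on coordinate `x`, and their exponents sum to at most 1, so Hölder applies to them.
    set U : ι → (D → R) → ℝ := fun a f => Real.log (𝔼 g, Real.exp (u a (T.piecewise g f))) with hU
    have hUexp : ∀ a f, Real.exp (U a f) = 𝔼 g, Real.exp (u a (T.piecewise g f)) := fun a f =>
      Real.exp_log (expect_pos (fun _ _ => Real.exp_pos _) univ_nonempty)
    have hconst : ∀ a, x ∉ Z a → ∀ g', U a (({x} : Finset D).piecewise g' f) = U a f := by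
      intro a ha g'
      simp only [hU]
      congr 1
      refine expect_congr rfl fun g _ => ?_
      congr 1
      refine hu a fun y hy => ?_
      have hyx : y ≠ x := by rintro rfl; exact ha hy
      by_cases hyT : y ∈ T <;> simp [hyT, hyx]
    have hsum : ∀ v : ι → ℝ, ∑ a, θ a * v a =
        ∑ a with x ∈ Z a, θ a * v a + ∑ a with x ∉ Z a, θ a * v a := fun v =>
      (sum_filter_add_sum_filter_not _ _ _).symm
    calc 𝔼 g, Real.exp (∑ a, θ a * u a ((insert x T).piecewise g f))
        = 𝔼 g', 𝔼 g, Real.exp (∑ a, θ a *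
            u a (T.piecewise g (({x} : Finset D).piecewise g' f))) :=
          (hsplit fun f => Real.exp (∑ a, θ a * u a f)).symm
      _ ≤ 𝔼 g', Real.exp (∑ a, θ a * U a (({x} : Finset D).piecewise g' f)) :=
          expect_le_expect fun g' _ => ih (fun y hy => hT y (mem_insert_of_mem hy)) _
      _ = (𝔼 g', Real.exp (∑ a with x ∈ Z a, θ a * U a (({x} : Finset D).piecewise g' f))) *
            Real.exp (∑ a with x ∉ Z a, θ a * U a f) := by
          rw [expect_mul]
          refine expect_congr rfl fun g' _ => ?_
          rw [hsum, Real.exp_add]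
          congr 2
          refine sum_congr rfl fun a ha => ?_
          rw [hconst a (mem_filter.1 ha).2]
      _ ≤ Real.exp (∑ a with x ∈ Z a, θ a *
              Real.log (𝔼 g', Real.exp (U a (({x} : Finset D).piecewise g' f)))) *
            Real.exp (∑ a with x ∉ Z a, θ a * U a f) := by
          gcongr
          exact expect_exp_sum_le _ θ (fun a _ => hθ a) (hT x (mem_insert_self _ _)) _
      _ = _ := by
          rw [← Real.exp_add, hsum]
          congr 2
          · refine sum_congr rfl fun a _ => ?_
            simp only [hUexp]
            rw [hsplit fun f => Real.exp (u a f)]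
          · refine sum_congr rfl fun a ha => ?_
            rw [← hsplit fun f => Real.exp (u a f)]
            simp only [← hUexp, hconst a (mem_filter.1 ha).2]
            rw [expect_const univ_nonempty, Real.log_exp]

end Resampling

/-! ### Short messages say little about lightly queried coordinates -/

section Message

variable {D R : Type*} [Fintype D] [DecidableEq D] [Fintype R]
variable {ι W : Type*} [Fintype ι] [Fintype W]

theorem expect_le_log_expect_exp {Ω : Type*} [Fintype Ω] [Nonempty Ω] (u : Ω → ℝ) :
    𝔼 ω, u ω ≤ Real.log (𝔼 ω, Real.exp (u ω)) := by
  have hpos : 0 < 𝔼 ω, Real.exp (u ω) :=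
    expect_pos (fun _ _ => Real.exp_pos _) univ_nonempty
  set c := Real.log (𝔼 ω, Real.exp (u ω)) with hc
  have h1 : 𝔼 ω, (u ω - c) ≤ 𝔼 ω, (Real.exp (u ω - c) - 1) :=
    expect_le_expect fun ω _ => by linarith [Real.add_one_le_exp (u ω - c)]
  simp only [Real.exp_sub, expect_sub_distrib, ← expect_div, expect_const univ_nonempty] at h1
  rw [hc, Real.exp_log hpos, div_self hpos.ne', ← hc] at h1
  linarith

/-- Follows from `exp u ≤ 1 + u + u²` for `|u| ≤ 1`, and `log y ≤ y - 1`. -/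
theorem log_expect_exp_le_sq {Ω : Type*} [Fintype Ω] [Nonempty Ω] (u : Ω → ℝ) {t : ℝ}
    (ht : t ≤ 1) (hu : ∀ ω, |u ω| ≤ t) (h0 : 𝔼 ω, u ω = 0) :
    Real.log (𝔼 ω, Real.exp (u ω)) ≤ t ^ 2 := by
  have hpos : 0 < 𝔼 ω, Real.exp (u ω) :=
    expect_pos (fun _ _ => Real.exp_pos _) univ_nonempty
  have h1 : 𝔼 ω, Real.exp (u ω) ≤ 𝔼 ω, (1 + u ω + t ^ 2) := by
    refine expect_le_expect fun ω _ => ?_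
    have h := (abs_le.1 (Real.abs_exp_sub_one_sub_id_le ((hu ω).trans ht))).2
    have h2 : u ω ^ 2 ≤ t ^ 2 := sq_le_sq' (neg_le_of_abs_le (hu ω)) (le_of_abs_le (hu ω))
    linarith
  simp only [expect_add_distrib, expect_const univ_nonempty, h0, add_zero] at h1
  linarith [Real.log_le_sub_one_of_pos hpos]

/-- A message `ω` about a uniformly random function that takes few values is nearly independent
of the restriction of the function to a random set that hits each coordinate outside of `S` with
small probability, given the restriction to `S`. -/
theorem sum_expect_test_le [Nonempty R] (S : Finset D) (X : ι → Finset D) (w : ι → ℝ)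
    (hw : ∀ a, 0 ≤ w a)
    {δ L : ℝ} (hδ : 0 < δ) (hL : 0 < L)
    (hX : ∀ x ∉ S, ∑ a with x ∈ X a, w a ≤ δ * ∑ a, w a)
    (hW : (Fintype.card W : ℝ) ≤ Real.exp L) (ω : (D → R) → W)
    (s : ι → W → (D → R) → ℝ) (hs0 : ∀ a k f, 0 ≤ s a k f) (hs1 : ∀ a k f, s a k f ≤ 1)
    (hs : ∀ a k, DependsOn (s a k) (↑(X a ∪ S) : Set D)) :
    ∑ a, w a * 𝔼 f, s a (ω f) f ≤
      ∑ a, w a * 𝔼 f, 𝔼 g, s a (ω f) (S.piecewise f g) + 2 * √(δ * L) * ∑ a, w a := by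
  set Wt := ∑ a, w a with hWt
  have hWt0 : 0 ≤ Wt := sum_nonneg fun a _ => hw a
  set t := √(δ * L) with ht
  have htpos : 0 < t := Real.sqrt_pos.2 (mul_pos hδ hL)
  have htsq : t ^ 2 = δ * L := Real.sq_sqrt (mul_pos hδ hL).le
  have hr0 : 0 ≤ ∑ a, w a * 𝔼 f, 𝔼 g, s a (ω f) (S.piecewise f g) :=
    sum_nonneg fun a _ => mul_nonneg (hw a)
      (expect_nonneg fun f _ => expect_nonneg fun g _ => hs0 _ _ _)
  have hl1 : ∑ a, w a * 𝔼 f, s a (ω f) f ≤ Wt :=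
    sum_le_sum fun a _ => mul_le_of_le_one_right (hw a)
      (expect_le univ_nonempty fun f _ => hs1 _ _ _)
  rcases hWt0.eq_or_lt with h0 | hWtpos
  · rw [← h0] at hl1 ⊢; linarith
  -- For `t > 1` the error term alone exceeds the left side; `t ≤ 1` is what the quadratic bound on
  -- the exponential moment needs.
  rcases lt_or_ge 1 t with ht1 | ht1
  · nlinarith
  set m : ι → W → (D → R) → ℝ := fun a k f => 𝔼 g, s a k (S.piecewise f g) with hm
  have hm0 : ∀ a k f, 0 ≤ m a k f := fun a k f => expect_nonneg fun g _ => hs0 _ _ _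
  have hm1 : ∀ a k f, m a k f ≤ 1 := fun a k f => expect_le univ_nonempty fun g _ => hs1 _ _ _
  have hmS : ∀ a k, ∀ f f' : D → R, (∀ x ∈ S, f x = f' x) → m a k f = m a k f' := by
    intro a k f f' h
    refine expect_congr rfl fun g _ => ?_
    congr 1
    funext x
    by_cases hx : x ∈ S <;> simp [hx, h]
  set u : W → ι → (D → R) → ℝ := fun k a f => t * (s a k f - m a k f) with hu
  have hudep : ∀ k a, DependsOn (u k a) (↑(X a ∪ S) : Set D) := by
    intro k a f f' h
    simp only [hu]
    rw [hs a k h, hmS a k f f' fun x hx => h x (by simp [hx])]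
  -- The largest multiple of `w` for which lightness off `S` ensures Finner's condition; the total
  -- exponent is `1/δ`.
  set θ : ι → ℝ := fun a => w a / (δ * Wt) with hθdef
  have hdW : 0 < δ * Wt := mul_pos hδ hWtpos
  have hθ : ∀ a, 0 ≤ θ a := fun a => div_nonneg (hw a) hdW.le
  have hθsum : ∑ a, θ a = 1 / δ := by
    rw [hθdef, ← sum_div, ← hWt]; field_simp
  have hcompl : ∀ f g : D → R, S.piecewise f g = Sᶜ.piecewise g f := by
    intro f g; funext x; by_cases hx : x ∈ S <;> simp [hx]
  -- With the values on `S` fixed, each `u k a` is centred and bounded by `t`, so the exponent is at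
  -- most `t²/δ`, which is `L` by the choice of `t`.
  have hk : ∀ k, 𝔼 f, Real.exp (∑ a, θ a * u k a f) ≤ Real.exp L := by
    intro k
    rw [← expect_piecewise S fun f => Real.exp (∑ a, θ a * u k a f)]
    refine expect_le univ_nonempty fun f _ => ?_
    simp only [hcompl f]
    refine (expect_exp_sum_piecewise_le θ hθ (fun a => X a ∪ S) (u k) (hudep k) Sᶜ ?_ f).trans ?_
    · intro x hx
      rw [mem_compl] at hx
      simp only [mem_union, hx, or_false, hθdef, ← sum_div]
      exact div_le_one_of_le₀ (hX x hx) hdW.le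
    · refine Real.exp_le_exp.2 ?_
      calc ∑ a, θ a * Real.log (𝔼 g, Real.exp (u k a (Sᶜ.piecewise g f)))
          ≤ ∑ a, θ a * t ^ 2 := by
            refine sum_le_sum fun a _ => mul_le_mul_of_nonneg_left ?_ (hθ a)
            refine log_expect_exp_le_sq _ ht1 (fun g => ?_) ?_
            · simp only [hu, abs_mul, abs_of_pos htpos]
              refine mul_le_of_le_one_right htpos.le (abs_le.2 ⟨?_, ?_⟩)
              · linarith [hs0 a k (Sᶜ.piecewise g f), hm1 a k (Sᶜ.piecewise g f)]
              · linarith [hs1 a k (Sᶜ.piecewise g f), hm0 a k (Sᶜ.piecewise g f)]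
            · have hmc : ∀ g, m a k (Sᶜ.piecewise g f) = m a k f := fun g =>
                hmS a k _ _ fun x hx => by simp [hx]
              simp only [hu, ← mul_expect, expect_sub_distrib, hmc, expect_const univ_nonempty]
              simp only [hm, ← hcompl, sub_self, mul_zero]
        _ = L := by
            rw [← sum_mul, hθsum, htsq]; field_simp
  -- The actual message value is handled by summing over all of them, which costs a second factor
  -- `exp L`.
  have hmain : 𝔼 f, ∑ a, θ a * u (ω f) a f ≤ 2 * L := by
    refine (expect_le_log_expect_exp _).trans ?_
    rw [Real.log_le_iff_le_exp (expect_pos (fun _ _ => Real.exp_pos _) univ_nonempty)]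
    calc 𝔼 f, Real.exp (∑ a, θ a * u (ω f) a f)
        ≤ 𝔼 f, ∑ k, Real.exp (∑ a, θ a * u k a f) :=
          expect_le_expect fun f _ => single_le_sum
            (f := fun k => Real.exp (∑ a, θ a * u k a f))
            (fun k _ => (Real.exp_pos _).le) (mem_univ (ω f))
      _ = ∑ k, 𝔼 f, Real.exp (∑ a, θ a * u k a f) := expect_sum_comm _ _ _
      _ ≤ ∑ _k : W, Real.exp L := sum_le_sum fun k _ => hk k
      _ = Fintype.card W * Real.exp L := by simp
      _ ≤ Real.exp L * Real.exp L := by gcongr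
      _ = Real.exp (2 * L) := by rw [← Real.exp_add]; ring_nf
  have heq : 𝔼 f, ∑ a, θ a * u (ω f) a f = t / (δ * Wt) * (∑ a, w a * 𝔼 f, s a (ω f) f -
      ∑ a, w a * 𝔼 f, m a (ω f) f) := by
    rw [expect_sum_comm, ← sum_sub_distrib, mul_sum]
    refine sum_congr rfl fun a _ => ?_
    simp only [hu, hθdef, ← mul_expect, expect_sub_distrib]
    ring
  rw [heq, div_mul_eq_mul_div, div_le_iff₀ hdW] at hmain
  have : t * (∑ a, w a * 𝔼 f, s a (ω f) f - ∑ a, w a * 𝔼 f, m a (ω f) f) ≤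
      t * (2 * t * Wt) := by
    calc _ ≤ _ := hmain
      _ = _ := by linear_combination (-2 * Wt) * htsq
  linarith [le_of_mul_le_mul_left this htpos]

/-- The total variation distance between the distributions of `ω` when the function is known to
agree with `f` on `V'`, respectively on `V`. -/
noncomputable def revealDist [DecidableEq W] (ω : (D → R) → W) (V V' : Finset D) (f : D → R) : ℝ :=
  ∑ k, max 0 ((𝔼 g, if ω (V'.piecewise f g) = k then 1 else 0) -
    𝔼 g, if ω (V.piecewise f g) = k then 1 else 0)

theorem expect_comp_eq_sum_mul {Ω W : Type*} [Fintype Ω] [Fintype W] [DecidableEq W]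
    (T : W → ℝ) (v : Ω → W) :
    𝔼 g, T (v g) = ∑ k, T k * 𝔼 g, if v g = k then (1 : ℝ) else 0 := by
  simp only [mul_expect, mul_ite, mul_one, mul_zero]
  rw [← expect_sum_comm]
  simp

section RevealDist

variable [DecidableEq W] (ω : (D → R) → W) (V V' : Finset D)

theorem revealDist_nonneg (f : D → R) : 0 ≤ revealDist ω V V' f :=
  sum_nonneg fun _ _ => le_max_left _ _

theorem revealDist_le_one [Nonempty R] (f : D → R) : revealDist ω V V' f ≤ 1 := by
  have hnn : ∀ (V : Finset D) k, 0 ≤ 𝔼 g, if ω (V.piecewise f g) = k then (1 : ℝ) else 0 := fun V k =>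
    expect_nonneg fun g _ => by split_ifs <;> norm_num
  calc revealDist ω V V' f
      ≤ ∑ k, 𝔼 g, if ω (V'.piecewise f g) = k then (1 : ℝ) else 0 :=
        sum_le_sum fun k _ => max_le (hnn V' k) (by linarith [hnn V k])
    _ = 1 := by
        have := expect_comp_eq_sum_mul (fun _ => 1) fun g => ω (V'.piecewise f g)
        simp only [one_mul, expect_const univ_nonempty] at this
        exact this.symm

theorem expect_sub_expect_le_revealDist (f : D → R) (T : W → ℝ) (hT0 : ∀ k, 0 ≤ T k)
    (hT1 : ∀ k, T k ≤ 1) :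
    𝔼 g, T (ω (V'.piecewise f g)) ≤
      𝔼 g, T (ω (V.piecewise f g)) + revealDist ω V V' f := by
  rw [expect_comp_eq_sum_mul T, expect_comp_eq_sum_mul T, revealDist, ← sum_add_distrib]
  refine sum_le_sum fun k _ => ?_
  set p := 𝔼 g, if ω (V'.piecewise f g) = k then (1 : ℝ) else 0
  set q := 𝔼 g, if ω (V.piecewise f g) = k then (1 : ℝ) else 0
  have h1 := le_max_left 0 (p - q)
  have h2 := le_max_right 0 (p - q)
  nlinarith [hT0 k, hT1 k]

-- This makes the distance a legitimate test of the oracle on the queries of `B`, although `V` and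
-- `V'` may be much larger.
variable {ω} in
theorem revealDist_dependsOn {Y : Set D} (hω : DependsOn ω Y) :
    DependsOn (revealDist ω V V') Y := by
  intro f f' h
  have : ∀ (V : Finset D) (g : D → R), ω (V.piecewise f g) = ω (V.piecewise f' g) := fun V g =>
    hω fun x hx => by by_cases hxV : x ∈ V <;> simp [hxV, h x hx]
  simp only [revealDist, this]

/-- A message that takes few values, about a uniformly random function, has nearly the same
distribution after the restriction of the function to a random set has been revealed. -/
theorem sum_expect_revealDist_le [Nonempty R] (S : Finset D) (X : ι → Finset D) (w : ι → ℝ)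
    (hw : ∀ a, 0 ≤ w a) {δ L : ℝ} (hδ : 0 < δ) (hL : 0 < L)
    (hX : ∀ x ∉ S, ∑ a with x ∈ X a, w a ≤ δ * ∑ a, w a)
    (hW : (Fintype.card W : ℝ) ≤ Real.exp L) :
    ∑ a, w a * 𝔼 f, revealDist ω S (X a ∪ S) f ≤ 2 * √(δ * L) * ∑ a, w a := by
  set P : Finset D → W → (D → R) → ℝ :=
    fun V k f => 𝔼 g, if ω (V.piecewise f g) = k then (1 : ℝ) else 0 with hP
  have hPdep : ∀ V k, ∀ f f' : D → R, (∀ x ∈ V, f x = f' x) → P V k f = P V k f' := by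
    intro V k f f' h
    have : ∀ g : D → R, V.piecewise f g = V.piecewise f' g := by
      intro g; funext x; by_cases hx : x ∈ V <;> simp [hx, h]
    simp only [hP, this]
  -- The optimal distinguisher: it accepts the values that became likelier after the revelation, so
  -- its advantage is the total variation distance.
  set s : ι → W → (D → R) → ℝ :=
    fun a k f => if P S k f < P (X a ∪ S) k f then 1 else 0 with hs
  have hsdep : ∀ a k, ∀ f f' : D → R, (∀ x ∈ X a ∪ S, f x = f' x) → s a k f = s a k f' := by
    intro a k f f' h
    simp only [hs]
    rw [hPdep S k f f' fun x hx => h x (mem_union_right _ hx), hPdep _ k f f' h]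
  have hrev : ∀ a f, revealDist ω S (X a ∪ S) f =
      𝔼 g, s a (ω ((X a ∪ S).piecewise f g)) f - 𝔼 g, s a (ω (S.piecewise f g)) f := by
    intro a f
    rw [expect_comp_eq_sum_mul (fun k => s a k f), expect_comp_eq_sum_mul (fun k => s a k f),
      ← sum_sub_distrib, revealDist]
    refine sum_congr rfl fun k _ => ?_
    change max 0 (P (X a ∪ S) k f - P S k f) =
      s a k f * P (X a ∪ S) k f - s a k f * P S k f
    simp only [hs]
    split_ifs with h
    · rw [max_eq_right (by linarith)]; ring
    · rw [max_eq_left (by linarith)]; ring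
  have h1 : ∀ a, 𝔼 f, 𝔼 g, s a (ω ((X a ∪ S).piecewise f g)) f = 𝔼 f, s a (ω f) f := by
    intro a
    rw [← expect_piecewise (X a ∪ S) fun f => s a (ω f) f]
    refine expect_congr rfl fun f _ => expect_congr rfl fun g _ => ?_
    exact hsdep a _ _ _ fun x hx => (piecewise_eq_of_mem _ _ _ hx).symm
  -- Off `S`, the oracle of the message and the oracle of the test are independent, so they may be
  -- exchanged.
  have h2 : ∀ a, 𝔼 f, 𝔼 g, s a (ω (S.piecewise f g)) f =
      𝔼 f, 𝔼 g, s a (ω f) (S.piecewise f g) := by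
    intro a
    rw [← expect_resample (fun _ => S) (fun _ _ => rfl) fun f g => s a (ω f) (S.piecewise f g)]
    refine expect_congr rfl fun f _ => expect_congr rfl fun g _ => ?_
    congr 1
    funext x
    by_cases hx : x ∈ S <;> simp [hx]
  have := sum_expect_test_le S X w hw hδ hL hX hW ω s
    (fun a k f => by simp only [hs]; split_ifs <;> norm_num)
    (fun a k f => by simp only [hs]; split_ifs <;> norm_num)
    (fun a k f f' h => hsdep a k f f' fun x hx => h x hx)
  simp only [hrev, expect_sub_distrib, h1, h2, mul_sub, sum_sub_distrib]
  linarith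

end RevealDist

end Message

/-! ### Heavy queries -/

section HeavySet

variable {D : Type*} [Fintype D] [DecidableEq D] {ι : Type*} [Fintype ι]

/-- The elements that lie in the random set `X`, for the weights `w`, with probability more than
`τ`. -/
noncomputable def heavySet (w : ι → ℝ) (X : ι → Finset D) (τ : ℝ) : Finset D :=
  univ.filter fun x => τ * ∑ a, w a < ∑ a with x ∈ X a, w a

theorem sum_le_of_notMem_heavySet {w : ι → ℝ} {X : ι → Finset D} {τ : ℝ} {x : D}
    (hx : x ∉ heavySet w X τ) : ∑ a with x ∈ X a, w a ≤ τ * ∑ a, w a := by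
  simpa [heavySet] using hx

theorem card_heavySet_mul_le {w : ι → ℝ} (hw : ∀ a, 0 ≤ w a) {X : ι → Finset D} (τ : ℝ)
    {l : ℕ} (hX : ∀ a, (X a).card ≤ l) : (heavySet w X τ).card * τ ≤ l := by
  rcases (sum_nonneg fun a (_ : a ∈ univ) => hw a).eq_or_lt with h0 | hpos
  · have hz : ∀ a, w a = 0 := fun a =>
      (sum_eq_zero_iff_of_nonneg fun a _ => hw a).1 h0.symm a (mem_univ a)
    simp [heavySet, hz]
  · refine le_of_mul_le_mul_right ?_ hpos
    -- Markov's inequality: the hitting weights of all points add up to the weighted size of `X`.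
    calc (heavySet w X τ).card * τ * ∑ a, w a
        = ∑ _x ∈ heavySet w X τ, τ * ∑ a, w a := by simp [mul_assoc]
      _ ≤ ∑ x ∈ heavySet w X τ, ∑ a with x ∈ X a, w a :=
          sum_le_sum fun x hx => (mem_filter.1 hx).2.le
      _ ≤ ∑ x, ∑ a with x ∈ X a, w a :=
          sum_le_univ_sum_of_nonneg fun x => sum_nonneg fun a _ => hw a
      _ = ∑ a, (X a).card * w a := by
          simp only [sum_filter]
          rw [sum_comm]
          refine sum_congr rfl fun a _ => ?_
          rw [← sum_filter]
          simp
      _ ≤ l * ∑ a, w a := by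
          rw [mul_sum]
          exact sum_le_sum fun a _ => mul_le_mul_of_nonneg_right (by exact_mod_cast hX a) (hw a)

end HeavySet

/-! ### Decoupling the two parties -/

section Protocol

variable {D R : Type*} [Fintype D] [DecidableEq D] [Fintype R]
variable {ι κ : Type*} {W₁ : Type*} [DecidableEq W₁]

/-- The weight of the coins `a` of the first party together with the event that her message is
`m`, when the oracle is known to agree with `f` on `H`. -/
noncomputable def jointWeight (α : ι → ℝ) (M : ι → (D → R) → W₁) (H : Finset D) (m : W₁)
    (f : D → R) (a : ι) : ℝ :=
  α a * 𝔼 g, if M a (H.piecewise f g) = m then 1 else 0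

variable {α : ι → ℝ} {β : κ → ℝ} {X : ι → Finset D} {Y : κ → Finset D}
  {M : ι → (D → R) → W₁} {H : Finset D} {δ L : ℝ}

theorem jointWeight_nonneg (hα : ∀ a, 0 ≤ α a) (m : W₁) (f : D → R) (a : ι) :
    0 ≤ jointWeight α M H m f a :=
  mul_nonneg (hα a) (expect_nonneg fun g _ => by split_ifs <;> norm_num)

theorem jointWeight_congr (m : W₁) {f f' : D → R} (h : ∀ x ∈ H, f x = f' x) :
    jointWeight α M H m f = jointWeight α M H m f' := by
  have : ∀ g : D → R, H.piecewise f g = H.piecewise f' g := by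
    intro g; funext x; by_cases hx : x ∈ H <;> simp [hx, h]
  funext a
  simp only [jointWeight, this]

theorem sum_jointWeight [Nonempty R] [Fintype W₁] (f : D → R) (a : ι) :
    ∑ m, jointWeight α M H m f a = α a := by
  have := expect_comp_eq_sum_mul (fun _ : W₁ => α a) fun g => M a (H.piecewise f g)
  simp only [expect_const univ_nonempty] at this
  exact this.symm

variable [Fintype ι]

/-- The queries of the eavesdropper: the set `H`, and the queries that the first party is likely
to ask given her message and the restriction of the oracle to `H`. -/
noncomputable def eveSet (α : ι → ℝ) (X : ι → Finset D) (M : ι → (D → R) → W₁) (H : Finset D)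
    (δ : ℝ) (m : W₁) (f : D → R) : Finset D :=
  H ∪ heavySet (jointWeight α M H m f) X δ

theorem eveSet_congr (m : W₁) {f f' : D → R} (h : ∀ x ∈ H, f x = f' x) :
    eveSet α X M H δ m f = eveSet α X M H δ m f' := by
  rw [eveSet, eveSet, jointWeight_congr m h]

theorem subset_eveSet (m : W₁) (f : D → R) : H ⊆ eveSet α X M H δ m f := subset_union_left

variable [Fintype κ] [Nonempty R] [Fintype W₁] {W : Type*} [Fintype W]
  {w : κ → W₁ → (D → R) → W} {T : ι → (D → R) → W → ℝ}

/-- The eavesdropper's queries nearly decouple the parties: the reply of the second party may be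
computed with an oracle that agrees with the actual one on these queries only. -/
theorem sum_expect_le_sum_expect_decoupled (hδ : 0 < δ) (hL : 0 < L)
    (hα : ∀ a, 0 ≤ α a) (hα1 : ∑ a, α a = 1) (hβ : ∀ b, 0 ≤ β b) (hβ1 : ∑ b, β b = 1)
    (hM : ∀ a, DependsOn (M a) (X a : Set D)) (hw : ∀ b m, DependsOn (w b m) (Y b : Set D))
    (hH : H = heavySet β Y δ) (hW₁ : (Fintype.card W₁ : ℝ) ≤ Real.exp L)
    (hW : (Fintype.card W : ℝ) ≤ Real.exp L)
    (hT0 : ∀ a f k, 0 ≤ T a f k) (hT1 : ∀ a f k, T a f k ≤ 1)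
    (hT : ∀ a f f' k, (∀ x ∈ X a ∪ eveSet α X M H δ (M a f) f, f x = f' x) →
      T a f k = T a f' k) :
    ∑ a, α a * ∑ b, β b * 𝔼 f, T a f (w b (M a f) f) ≤
      ∑ a, α a * ∑ b, β b * 𝔼 f, 𝔼 g,
        T a f (w b (M a f) ((eveSet α X M H δ (M a f) f).piecewise f g)) + 4 * √(δ * L) := by
  classical
  set S : W₁ → (D → R) → Finset D := eveSet α X M H δ with hS
  set φ : ι → κ → W₁ → (D → R) → ℝ :=
    fun a b m f => revealDist (w b m) (S m f) (X a ∪ S m f) f with hφ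
  have hSH : ∀ m (f g : D → R), S m (H.piecewise f g) = S m f := fun m f g =>
    eveSet_congr m fun x hx => by simp [hx]
  -- Off `X a ∪ S` the oracle is fresh given the view of `A` and the answers on `S`. Forgetting the
  -- answers on `X a` when computing the reply then costs `φ`.
  have hreal : ∀ a b, 𝔼 f, T a f (w b (M a f) f) ≤
      𝔼 f, 𝔼 g, T a f (w b (M a f) ((S (M a f) f).piecewise f g)) + 𝔼 f, φ a b (M a f) f := by
    intro a b
    have hMV : ∀ f g, M a ((X a ∪ S (M a f) f).piecewise f g) = M a f := fun f g =>
      hM a fun x hx => by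
        have : x ∈ X a := hx
        simp [this]
    have hV : ∀ f g, X a ∪ S (M a ((X a ∪ S (M a f) f).piecewise f g))
        ((X a ∪ S (M a f) f).piecewise f g) = X a ∪ S (M a f) f := by
      intro f g
      rw [hMV]
      congr 1
      refine eveSet_congr _ fun x hx => ?_
      have : x ∈ S (M a f) f := subset_eveSet _ _ hx
      simp [this]
    rw [← expect_resample_left (fun f => X a ∪ S (M a f) f) hV fun f => T a f (w b (M a f) f),
      ← expect_add_distrib]
    refine expect_le_expect fun f _ => ?_
    have hTV : ∀ g k, T a ((X a ∪ S (M a f) f).piecewise f g) k = T a f k := fun g k =>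
      (hT a f _ k fun x hx => (piecewise_eq_of_mem _ _ _ hx).symm).symm
    simp only [hMV, hTV]
    exact expect_sub_expect_le_revealDist (w b (M a f)) _ _ f (T a f) (hT0 a f) (hT1 a f)
  -- First use of the message lemma: `φ` reads the oracle only on `Y b ∪ H`, the queries of `B` are
  -- light off `H`, and the message is that of `A`.
  have hstep : ∀ a, ∑ b, β b * 𝔼 f, φ a b (M a f) f ≤
      ∑ b, β b * 𝔼 f, 𝔼 g, φ a b (M a f) (H.piecewise f g) + 2 * √(δ * L) := by
    intro a
    have := sum_expect_test_le H Y β hβ hδ hL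
      (fun x hx => sum_le_of_notMem_heavySet (hH ▸ hx)) hW₁ (M a) (fun b m f => φ a b m f)
      (fun _ _ _ => revealDist_nonneg _ _ _ _) (fun _ _ _ => revealDist_le_one _ _ _ _)
      (fun b m f f' h => by
        simp only [hφ]
        rw [show S m f = S m f' from eveSet_congr m fun x hx => h x (by simp [hx])]
        exact revealDist_dependsOn _ _ (hw b m) fun x hx => h x (by
          have : x ∈ Y b := hx
          simp [this]))
    rwa [hβ1, mul_one] at this
  have hswap : ∀ a b, 𝔼 f, 𝔼 g, φ a b (M a f) (H.piecewise f g) =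
      𝔼 f, ∑ m, (𝔼 g, if M a (H.piecewise f g) = m then (1 : ℝ) else 0) * φ a b m f := by
    intro a b
    rw [← expect_resample (fun _ => H) (fun _ _ => rfl)
      fun f g => φ a b (M a f) (H.piecewise f g)]
    refine expect_congr rfl fun f _ => ?_
    have : ∀ g, H.piecewise (H.piecewise f g) (H.piecewise g f) = f := by
      intro g; funext x; by_cases hx : x ∈ H <;> simp [hx]
    simp only [this]
    rw [expect_comp_eq_sum_mul (fun m => φ a b m f)]
    exact sum_congr rfl fun m _ => mul_comm _ _
  -- Second use, with the reply of `B` as message. Once the values `h` on `H` are fixed, the weights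
  -- and `S m h` are constant, and `X a` is light off `S m h` under these weights.
  have hpost : ∀ m b, 𝔼 f, ∑ a, jointWeight α M H m f a * φ a b m f ≤
      𝔼 f : D → R, 2 * √(δ * L) * ∑ a, jointWeight α M H m f a := by
    intro m b
    rw [← expect_piecewise H fun f => ∑ a, jointWeight α M H m f a * φ a b m f]
    refine expect_le_expect fun h _ => ?_
    have hj : ∀ f : D → R, jointWeight α M H m (H.piecewise h f) = jointWeight α M H m h :=
      fun f => jointWeight_congr m fun x hx => by simp [hx]
    have hφh : ∀ a f, φ a b m (H.piecewise h f) =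
        revealDist (fun f => w b m (H.piecewise h f)) (S m h) (X a ∪ S m h) f := by
      intro a f
      have hpw : ∀ (V : Finset D), H ⊆ V → ∀ g : D → R,
          V.piecewise (H.piecewise h f) g = H.piecewise h (V.piecewise f g) := by
        intro V hV g
        funext x
        by_cases hx : x ∈ H
        · simp [hx, hV hx]
        · by_cases hxV : x ∈ V <;> simp [hx, hxV]
      change revealDist (w b m) (S m (H.piecewise h f)) (X a ∪ S m (H.piecewise h f)) _ = _
      rw [hSH]
      simp only [revealDist, hpw (S m h) (subset_eveSet m h),
        hpw (X a ∪ S m h) ((subset_eveSet m h).trans subset_union_right)]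
    simp only [hj, hφh, expect_sum_comm, ← mul_expect]
    exact sum_expect_revealDist_le _ (S m h) X _ (jointWeight_nonneg hα m h) hδ hL
      (fun x hx => sum_le_of_notMem_heavySet fun hx' => hx (mem_union_right _ hx')) hW
  have hlast : ∑ a, α a * ∑ b, β b * 𝔼 f, 𝔼 g, φ a b (M a f) (H.piecewise f g) ≤
      2 * √(δ * L) := by
    calc ∑ a, α a * ∑ b, β b * 𝔼 f, 𝔼 g, φ a b (M a f) (H.piecewise f g)
        = ∑ b, β b * ∑ m, 𝔼 f, ∑ a, jointWeight α M H m f a * φ a b m f := by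
          simp only [hswap, jointWeight, expect_sum_comm, mul_sum, mul_expect]
          rw [sum_comm]
          refine sum_congr rfl fun b _ => ?_
          rw [sum_comm]
          refine sum_congr rfl fun m _ => sum_congr rfl fun a _ => expect_congr rfl fun f _ => ?_
          simp only [← mul_expect]
          ring
      _ ≤ ∑ b, β b * ∑ m, 𝔼 f : D → R, 2 * √(δ * L) * ∑ a, jointWeight α M H m f a :=
          sum_le_sum fun b _ => mul_le_mul_of_nonneg_left
            (sum_le_sum fun m _ => hpost m b) (hβ b)
      _ = 2 * √(δ * L) := by
          rw [← sum_mul, hβ1, one_mul, ← expect_sum_comm]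
          simp only [← mul_sum]
          have : ∀ f : D → R, ∑ m, ∑ a, jointWeight α M H m f a = 1 := by
            intro f
            rw [sum_comm]
            simp only [sum_jointWeight, hα1]
          simp [this]
  have h1 : ∑ a, α a * ∑ b, β b * 𝔼 f, T a f (w b (M a f) f) ≤
      ∑ a, α a * (∑ b, β b * 𝔼 f, 𝔼 g, T a f (w b (M a f) ((S (M a f) f).piecewise f g)) +
        (∑ b, β b * 𝔼 f, 𝔼 g, φ a b (M a f) (H.piecewise f g) + 2 * √(δ * L))) := by
    refine sum_le_sum fun a _ => mul_le_mul_of_nonneg_left ?_ (hα a)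
    refine le_trans ?_ (add_le_add_right (hstep a) _)
    rw [← sum_add_distrib]
    refine sum_le_sum fun b _ => ?_
    rw [← mul_add]
    exact mul_le_mul_of_nonneg_left (hreal a b) (hβ b)
  simp only [mul_add, sum_add_distrib, ← sum_mul, hα1] at h1
  linarith

end Protocol

/-! ### The eavesdropper's guess -/

section Guess

variable {D R : Type*} [Fintype D] [DecidableEq D] [Fintype R] [Nonempty R]
variable {ι κ : Type*} [Fintype ι] [Fintype κ] {W₁ : Type*} [DecidableEq W₁] [Fintype W₁]

/-- The reply sees the oracle `f` only on `S`, so resampling `f` off `S` makes the reply independent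
of the view of `A` given the first message and the answers on `S`. The product form allows a
comparison reply by reply. -/
theorem sum_expect_decoupled_eq {W : Type*} [Fintype W] [DecidableEq W] (α : ι → ℝ) (β : κ → ℝ)
    (M : ι → (D → R) → W₁) (w : κ → W₁ → (D → R) → W) (S : W₁ → (D → R) → Finset D)
    (hS : ∀ m f g, S m ((S m f).piecewise f g) = S m f) (T : W₁ → ι → (D → R) → W → ℝ) :
    ∑ a, α a * ∑ b, β b * 𝔼 f, 𝔼 g,
        T (M a f) a f (w b (M a f) ((S (M a f) f).piecewise f g)) =
      ∑ m, 𝔼 f, ∑ k, (∑ b, β b * 𝔼 g, if w b m ((S m f).piecewise f g) = k then 1 else 0) *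
        𝔼 g, ∑ a, α a * if M a ((S m f).piecewise f g) = m then
          T m a ((S m f).piecewise f g) k else 0 := by
  set q : W₁ → (D → R) → W → ℝ :=
    fun m f k => ∑ b, β b * 𝔼 g, if w b m ((S m f).piecewise f g) = k then 1 else 0 with hq
  have hpw : ∀ m (f g h : D → R), (S m f).piecewise ((S m f).piecewise f g) h =
      (S m f).piecewise f h := by
    intro m f g h; funext x; by_cases hx : x ∈ S m f <;> simp [hx]
  have hqS : ∀ m f g, q m ((S m f).piecewise f g) = q m f := by
    intro m f g
    funext k
    simp only [hq]
    rw [hS]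
    simp only [hpw]
  have hres : ∀ m, 𝔼 f, ∑ k, q m f k * ∑ a, α a * (if M a f = m then T m a f k else 0) =
      𝔼 f, ∑ k, q m f k * 𝔼 g, ∑ a, α a * if M a ((S m f).piecewise f g) = m then
          T m a ((S m f).piecewise f g) k else 0 := by
    intro m
    rw [← expect_resample_left (S m) (hS m)
      fun f => ∑ k, q m f k * ∑ a, α a * (if M a f = m then T m a f k else 0)]
    simp only [hqS, expect_sum_comm univ univ (fun f k => q m _ k * _), mul_expect]
  rw [← sum_congr rfl fun m _ => hres m, ← expect_sum_comm]
  simp only [hq, mul_sum, mul_expect, sum_mul, expect_mul, ← expect_sum_comm]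
  refine expect_congr rfl fun f _ => ?_
  have : ∀ a b, 𝔼 g, α a * (β b * T (M a f) a f (w b (M a f) ((S (M a f) f).piecewise f g))) =
      ∑ m, ∑ k, 𝔼 g, (β b * if w b m ((S m f).piecewise f g) = k then 1 else 0) *
        (α a * if M a f = m then T m a f k else 0) := by
    intro a b
    rw [sum_eq_single (M a f) (fun m _ hm => by simp [hm.symm]) (by simp), ← expect_sum_comm]
    refine expect_congr rfl fun g _ => ?_
    rw [sum_eq_single (w b (M a f) ((S (M a f) f).piecewise f g))
      (fun k _ hk => by simp [hk.symm]) (by simp)]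
    simp only [if_true]
    ring
  simp only [expect_sum_comm, this]
  have hcomm : ∀ G : ι → κ → W₁ → W → ℝ,
      ∑ a, ∑ b, ∑ m, ∑ k, G a b m k = ∑ m, ∑ k, ∑ a, ∑ b, G a b m k := by
    intro G
    simp only [← Fintype.sum_prod_type']
    exact Fintype.sum_equiv ⟨fun p => (p.2.2.1, p.2.2.2, p.1, p.2.1),
      fun p => (p.2.2.1, p.2.2.2, p.1, p.2.1), fun _ => rfl, fun _ => rfl⟩ _ _ fun _ => rfl
  exact hcomm fun a b m k => 𝔼 g, (β b * if w b m ((S m f).piecewise f g) = k then 1 else 0) *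
    (α a * if M a f = m then T m a f k else 0)

/-- In a two-message protocol with non-adaptive queries, an eavesdropper that sees the messages and
asks few queries guesses the output of the first party almost as well as the second party does. -/
theorem exists_guess {W₂ : Type*} [Fintype W₂] [DecidableEq W₂]
    {α : ι → ℝ} {β : κ → ℝ} {X : ι → Finset D} {Y : κ → Finset D}
    {M : ι → (D → R) → W₁} {w : κ → W₁ → (D → R) → W₂ × Bool} {out : ι → (D → R) → W₂ → Bool}
    {δ L : ℝ} {l : ℕ} (hδ : 0 < δ) (hL : 0 < L)
    (hα : ∀ a, 0 ≤ α a) (hα1 : ∑ a, α a = 1) (hβ : ∀ b, 0 ≤ β b) (hβ1 : ∑ b, β b = 1)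
    (hX : ∀ a, (X a).card ≤ l) (hY : ∀ b, (Y b).card ≤ l)
    (hM : ∀ a, DependsOn (M a) (X a : Set D)) (hw : ∀ b m, DependsOn (w b m) (Y b : Set D))
    (hout : ∀ a, DependsOn (out a) (X a : Set D))
    (hW₁ : (Fintype.card W₁ : ℝ) ≤ Real.exp L)
    (hW : (Fintype.card (W₂ × Bool) : ℝ) ≤ Real.exp L) :
    ∃ (H : Finset D) (Q : W₁ → (D → R) → Finset D) (guess : W₁ → W₂ → (D → R) → Bool),
      H.card * δ ≤ l ∧ (∀ m f, (Q m f).card * δ ≤ l) ∧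
      (∀ m, DependsOn (Q m) (H : Set D)) ∧
      (∀ m k f g, guess m k ((H ∪ Q m f).piecewise f g) = guess m k f) ∧
      ∑ a, α a * ∑ b, β b * 𝔼 f, (if out a f (w b (M a f) f).1 = (w b (M a f) f).2
          then (1 : ℝ) else 0) ≤
        ∑ a, α a * ∑ b, β b * 𝔼 f, (if guess (M a f) (w b (M a f) f).1 f =
          out a f (w b (M a f) f).1 then (1 : ℝ) else 0) + 8 * √(δ * L) := by
  set H := heavySet β Y δ with hH
  set S : W₁ → (D → R) → Finset D := eveSet α X M H δ with hS
  have hSS : ∀ m f g, S m ((S m f).piecewise f g) = S m f := fun m f g =>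
    eveSet_congr m fun x hx => piecewise_eq_of_mem _ _ _ (subset_eveSet m f hx)
  have hpw : ∀ m (f g h : D → R), (S m f).piecewise ((S m f).piecewise f g) h =
      (S m f).piecewise f h := by
    intro m f g h; funext x; by_cases hx : x ∈ S m f <;> simp [hx]
  -- The unnormalised posterior weight of the output `o` of `A`; a common normalisation would not
  -- change which output is likelier.
  set acc : W₁ → (D → R) → W₂ → Bool → ℝ := fun m f k o =>
    𝔼 g, ∑ a, α a * if M a ((S m f).piecewise f g) = m then
      (if out a ((S m f).piecewise f g) k = o then (1 : ℝ) else 0) else 0 with hacc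
  set guess : W₁ → W₂ → (D → R) → Bool :=
    fun m k f => decide (acc m f k false ≤ acc m f k true) with hguess
  have hgS : ∀ m k f g, guess m k ((S m f).piecewise f g) = guess m k f := by
    intro m k f g
    have : ∀ o, acc m ((S m f).piecewise f g) k o = acc m f k o := by
      intro o
      simp only [hacc]
      rw [hSS]
      simp only [hpw]
    simp only [hguess, this]
  have hbest : ∀ m k f o, acc m f k o ≤ acc m f k (guess m k f) := by
    intro m k f o
    simp only [hguess]
    by_cases h : acc m f k false ≤ acc m f k true
    · cases o <;> simp [h]
    · cases o <;> simp [h, (not_le.1 h).le]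
  refine ⟨H, fun m f => heavySet (jointWeight α M H m f) X δ, guess,
    card_heavySet_mul_le hβ δ hY, fun m f => card_heavySet_mul_le (jointWeight_nonneg hα m f) δ hX,
    fun m f f' h => by simp only [jointWeight_congr m h], hgS, ?_⟩
  have hagree := sum_expect_le_sum_expect_decoupled (α := α) (β := β) (X := X) (Y := Y) (M := M)
    (H := H) (w := w) (T := fun a f k => if out a f k.1 = k.2 then 1 else 0)
    hδ hL hα hα1 hβ hβ1 hM hw rfl hW₁ hW
    (fun _ _ _ => by split_ifs <;> norm_num) (fun _ _ _ => by split_ifs <;> norm_num)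
    (fun a f f' k h => by
      rw [hout a fun x hx => h x (mem_union_left _ hx)])
  -- Applied to the failure of the guess, because decoupling gives only upper bounds and the success
  -- must be bounded from below.
  have hcorrect := sum_expect_le_sum_expect_decoupled (α := α) (β := β) (X := X) (Y := Y) (M := M)
    (H := H) (w := w) (T := fun a f k => 1 - if out a f k.1 = guess (M a f) k.1 f then 1 else 0)
    hδ hL hα hα1 hβ hβ1 hM hw rfl hW₁ hW
    (fun _ _ _ => by split_ifs <;> norm_num) (fun _ _ _ => by split_ifs <;> norm_num)
    (fun a f f' k h => by
      have hf' : (S (M a f) f).piecewise f' f' = (S (M a f) f).piecewise f f' := by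
        funext x
        by_cases hx : x ∈ S (M a f) f
        · simp [hx, h x (mem_union_right _ hx)]
        · simp [hx]
      rw [piecewise_same] at hf'
      have hMf : M a f' = M a f := (hM a fun x hx => h x (mem_union_left _ hx)).symm
      have hg : guess (M a f) k.1 f' = guess (M a f) k.1 f := by
        rw [hf', hgS]
      rw [hMf, hg, hout a fun x hx => h x (mem_union_left _ hx)])
  simp only [mul_sub, expect_sub_distrib, sum_sub_distrib, expect_const univ_nonempty, mul_one,
    hβ1, hα1] at hcorrect
  -- In the decoupled experiment the output bit of `B` is just another guess made without further
  -- information on `A`.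
  have hdec : ∑ a, α a * ∑ b, β b * 𝔼 f, 𝔼 g,
        (if out a f (w b (M a f) ((S (M a f) f).piecewise f g)).1 =
          (w b (M a f) ((S (M a f) f).piecewise f g)).2 then (1 : ℝ) else 0) ≤
      ∑ a, α a * ∑ b, β b * 𝔼 f, 𝔼 g,
        (if out a f (w b (M a f) ((S (M a f) f).piecewise f g)).1 =
          guess (M a f) (w b (M a f) ((S (M a f) f).piecewise f g)).1 f then (1 : ℝ) else 0) := by
    rw [sum_expect_decoupled_eq α β M w S hSS
        fun m a f k => if out a f k.1 = k.2 then (1 : ℝ) else 0,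
      sum_expect_decoupled_eq α β M w S hSS
        fun m a f k => if out a f k.1 = guess m k.1 f then (1 : ℝ) else 0]
    simp only [hgS]
    refine sum_le_sum fun m _ => expect_le_expect fun f _ => sum_le_sum fun k _ => ?_
    refine mul_le_mul_of_nonneg_left (hbest m k.1 f k.2) ?_
    exact sum_nonneg fun b _ => mul_nonneg (hβ b)
      (expect_nonneg fun g _ => by split_ifs <;> norm_num)
  simp only [eq_comm (a := guess _ _ _)]
  linarith

end Guess

/-! ### Oracle algorithms that ask a set of queries -/

namespace OracleAlg

variable {D R O : Type}

theorem QueriesAtMost.mono {e : OracleAlg D R O} {q q' : ℕ} (h : e.QueriesAtMost q)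
    (hq : q ≤ q') : e.QueriesAtMost q' := by
  induction e generalizing q q' with
  | output o => trivial
  | query d next ih =>
    cases q with
    | zero => exact h.elim
    | succ q =>
      obtain ⟨p, rfl⟩ : ∃ p, q' = p + 1 := ⟨q' - 1, by omega⟩
      exact fun r => ih r (h r) (by omega)

/-- An algorithm may first ask a given set of queries. -/
theorem exists_query_finset [DecidableEq D] (S : Finset D) (f₀ : D → R)
    (k : (D → R) → OracleAlg D R O) {q : ℕ} (hk : ∀ f, (k f).QueriesAtMost q) :
    ∃ e : OracleAlg D R O, e.QueriesAtMost (S.card + q) ∧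
      ∀ f, e.run f = (k (S.piecewise f f₀)).run f := by
  induction S using Finset.induction_on generalizing f₀ with
  | empty => exact ⟨k f₀, by simpa using hk f₀, fun f => by simp⟩
  | insert x S hx ih =>
    -- The answers received so far are stored in the default function `f₀`.
    choose e he hrun using fun r => ih (Function.update f₀ x r)
    refine ⟨.query x e, ?_, fun f => ?_⟩
    · rw [card_insert_of_notMem hx, Nat.add_right_comm]
      exact he
    · rw [OracleAlg.run, hrun, piecewise_insert]
      congr 2
      funext y
      by_cases hy : y ∈ S
      · have : y ≠ x := by rintro rfl; exact hx hy
        simp [hy, this]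
      · by_cases hyx : y = x
        · subst hyx; simp [hy]
        · simp [hy, hyx]

end OracleAlg

/-! ### Finite sums for discrete probabilities -/

section Prob

open Classical in
theorem prob_eq_sum {Ω : Type} [Fintype Ω] (p : PMF Ω) (S : Set Ω) :
    prob p S = ∑ x, (p x).toReal * if x ∈ S then 1 else 0 := by
  rw [prob, PMF.toOuterMeasure_apply, tsum_fintype,
    ENNReal.toReal_sum fun x _ => ne_top_of_le_ne_top (p.apply_ne_top x)
      (Set.indicator_le_self _ _ _)]
  refine sum_congr rfl fun x _ => ?_
  by_cases hx : x ∈ S <;> simp [hx]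

theorem prob_bind {Ω Ω' : Type} [Fintype Ω] (p : PMF Ω) (h : Ω → PMF Ω') (S : Set Ω') :
    prob (p.bind h) S = ∑ x, (p x).toReal * prob (h x) S := by
  have hle : ∀ x, (h x).toOuterMeasure S ≠ ⊤ := fun x =>
    ne_top_of_le_ne_top ENNReal.one_ne_top <| by
      rw [PMF.toOuterMeasure_apply, ← (h x).tsum_coe]
      exact ENNReal.tsum_le_tsum fun y => Set.indicator_le_self _ _ _
  rw [prob, PMF.toOuterMeasure_bind_apply, tsum_fintype,
    ENNReal.toReal_sum fun x _ => ENNReal.mul_ne_top (p.apply_ne_top x) (hle x)]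
  simp [prob]

theorem prob_map {Ω Ω' : Type} (p : PMF Ω) (g : Ω → Ω') (S : Set Ω') :
    prob (p.map g) S = prob p (g ⁻¹' S) := by
  rw [prob, prob, PMF.toOuterMeasure_map_apply]

theorem prob_congr {Ω : Type} (p : PMF Ω) {S S' : Set Ω}
    (h : ∀ x ∈ p.support, x ∈ S ↔ x ∈ S') : prob p S = prob p S' := by
  rw [prob, prob, PMF.toOuterMeasure_apply_eq_of_inter_support_eq]
  ext x
  by_cases hx : x ∈ p.support <;> simp only [Set.mem_inter_iff, hx, and_true, and_false]
  exact h x hx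

theorem sum_support {Ω : Type} [Fintype Ω] (p : PMF Ω) [Fintype p.support] (K : Ω → ℝ) :
    ∑ x : p.support, (p x).toReal * K x = ∑ x, (p x).toReal * K x := by
  classical
  rw [← Finset.sum_subtype (univ.filter (· ∈ p.support)) (by simp)
    (fun x => (p x).toReal * K x)]
  refine sum_filter_of_ne fun x _ hx => ?_
  rw [PMF.mem_support_iff]
  rintro h
  simp [h] at hx

theorem sum_toReal {Ω : Type} [Fintype Ω] (p : PMF Ω) : ∑ x, (p x).toReal = 1 := by
  rw [← ENNReal.toReal_sum fun x _ => p.apply_ne_top x, ← tsum_fintype (L := .unconditional _),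
    p.tsum_coe, ENNReal.toReal_one]

end Prob

/-! ### Counting messages -/

/-- Bit strings of length at most `c`. -/
abbrev Msg (c : ℕ) : Type := {s : List Bool // s.length ≤ c}

instance (c : ℕ) : Finite (Msg c) := (List.finite_length_le Bool c).to_subtype

noncomputable instance (c : ℕ) : Fintype (Msg c) := Fintype.ofFinite _

theorem card_msg_le (c : ℕ) : Fintype.card (Msg c) ≤ 4 ^ c := by
  -- A string is recovered from its length and its padding by `false` to length `c`.
  have hinj : Function.Injective fun s : Msg c =>
      ((⟨s.1.length, by have := s.2; omega⟩ : Fin (c + 1)), fun i : Fin c => s.1.getD i false) := by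
    rintro ⟨s, hs⟩ ⟨s', hs'⟩ h
    simp only [Prod.mk.injEq, Fin.mk.injEq] at h
    refine Subtype.ext (List.ext_getElem h.1 fun i hi hi' => ?_)
    have := congrFun h.2 ⟨i, hi.trans_le hs⟩
    simpa [hi, hi'] using this
  calc Fintype.card (Msg c) ≤ Fintype.card (Fin (c + 1) × (Fin c → Bool)) :=
        Fintype.card_le_of_injective _ hinj
    _ = (c + 1) * 2 ^ c := by simp
    _ ≤ 2 ^ c * 2 ^ c := Nat.mul_le_mul_right _ Nat.lt_two_pow_self
    _ = 4 ^ c := by rw [← mul_pow]; norm_num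

/-- Replaces a string of length more than `c` by the empty string. -/
def Msg.ofList (c : ℕ) (s : List Bool) : Msg c := if h : s.length ≤ c then ⟨s, h⟩ else ⟨[], by simp⟩

theorem Msg.coe_ofList {c : ℕ} {s : List Bool} (h : s.length ≤ c) :
    (Msg.ofList c s : List Bool) = s := by
  simp [Msg.ofList, h]

theorem card_msg_prod_bool_le (c : ℕ) :
    (Fintype.card (Msg c × Bool) : ℝ) ≤ Real.exp (2 * c + 1) := by
  have h : (Fintype.card (Msg c × Bool) : ℝ) ≤ 4 ^ c * 2 := by
    rw [Fintype.card_prod, Fintype.card_bool]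
    exact_mod_cast Nat.mul_le_mul_right 2 (card_msg_le c)
  have h2 : (2 : ℝ) ≤ Real.exp 1 := by linarith [Real.add_one_le_exp 1]
  calc (Fintype.card (Msg c × Bool) : ℝ) ≤ 4 ^ c * 2 := h
    _ = 2 ^ (2 * c + 1) := by rw [pow_succ, pow_mul]; norm_num
    _ ≤ Real.exp 1 ^ (2 * c + 1) := by gcongr
    _ = Real.exp (2 * c + 1) := by rw [← Real.exp_nat_mul]; push_cast; ring_nf

/-! ### From protocols to the finite setting -/

namespace TwoMessageProtocol

variable {n : ℕ} (P : TwoMessageProtocol n) (c : ℕ)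

/-- What matters of the coins of `A`: her set of queries, and her message and her output as
functions of the oracle, for messages of length at most `c`. -/
abbrev BehaviorA (n c : ℕ) : Type :=
  Finset (Bits n) × ((Bits n → Bits n) → Msg c) × ((Bits n → Bits n) → Msg c → Bool)

/-- What matters of the coins of `B`: his set of queries, and his message and his output as
functions of the first message and the oracle, for messages of length at most `c`. -/
abbrev BehaviorB (n c : ℕ) : Type :=
  Finset (Bits n) × (Msg c → (Bits n → Bits n) → Msg c × Bool)

/-- The behavior of `A` with given coins. -/
def behaviorA (a : P.CoinsA) : BehaviorA n c :=
  ((P.queriesA a).toFinset, fun f => Msg.ofList c (P.msgA a ((P.queriesA a).map f)),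
    fun f m => P.outputA a ((P.queriesA a).map f) m)

/-- The behavior of `B` with given coins. -/
def behaviorB (b : P.CoinsB) : BehaviorB n c :=
  ((P.queriesB b).toFinset, fun m f => (Msg.ofList c (P.msgB b ((P.queriesB b).map f) m),
    P.outputB b ((P.queriesB b).map f) m))

theorem coins_map {Ω Ω' : Type} (g : P.CoinsA → Ω) (g' : P.CoinsB → Ω') :
    P.coins.map (fun v => (g v.1, g' v.2)) =
      (P.coinsA.map g).bind fun x => (P.coinsB.map g').map fun y => (x, y) := by
  simp only [coins, PMF.map_bind, PMF.bind_map, PMF.map_comp]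
  rfl

theorem prob_coins_behavior (K : BehaviorA n c → BehaviorB n c → Prop)
    [∀ x y, Decidable (K x y)]
    [Fintype (P.coinsA.map (P.behaviorA c)).support]
    [Fintype (P.coinsB.map (P.behaviorB c)).support] :
    prob P.coins {v | K (P.behaviorA c v.1) (P.behaviorB c v.2)} =
      ∑ a : (P.coinsA.map (P.behaviorA c)).support,
        ((P.coinsA.map (P.behaviorA c)) a).toReal *
      ∑ b : (P.coinsB.map (P.behaviorB c)).support,
        ((P.coinsB.map (P.behaviorB c)) b).toReal * if K a b then 1 else 0 := by
  have h1 : prob P.coins {v | K (P.behaviorA c v.1) (P.behaviorB c v.2)} =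
      prob (P.coins.map fun v => (P.behaviorA c v.1, P.behaviorB c v.2)) {p | K p.1 p.2} := by
    rw [prob_map]; rfl
  rw [h1, coins_map, prob_bind,
    sum_support _ fun x => ∑ b : (P.coinsB.map (P.behaviorB c)).support,
      ((P.coinsB.map (P.behaviorB c)) b).toReal * if K x b then (1 : ℝ) else 0]
  refine sum_congr rfl fun x _ => ?_
  rw [sum_support _ fun y => if K x y then (1 : ℝ) else 0]
  classical
  rw [prob_map, prob_eq_sum]
  refine congrArg _ (sum_congr rfl fun y _ => congrArg _ ?_)
  exact if_congr Iff.rfl rfl rfl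

/-- Coin spaces may be infinite, but an execution depends on the coins only through the induced
behaviors, which form a finite type. Only behaviors in the support are kept, since the query bound
holds just for coins of positive probability. -/
theorem exists_guess_of_commComplexity {l : ℕ} {δ : ℝ} (hδ : 0 < δ) (hP : P.IsQueryBounded l)
    (hc : ∀ f, ∀ v ∈ P.coins.support, (P.message₁ f v).length + (P.message₂ f v).length ≤ c) :
    ∃ (H : Finset (Bits n)) (Q : Msg c → (Bits n → Bits n) → Finset (Bits n))
      (guess : Msg c → Msg c → (Bits n → Bits n) → Bool),
      H.card * δ ≤ l ∧ (∀ m f, (Q m f).card * δ ≤ l) ∧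
      (∀ m, DependsOn (Q m) (H : Set (Bits n))) ∧
      (∀ m k f g, guess m k ((H ∪ Q m f).piecewise f g) = guess m k f) ∧
      𝔼 f, prob P.coins {v | P.outA f v = P.outB f v} ≤
        𝔼 f, prob P.coins {v | guess (Msg.ofList c (P.message₁ f v))
          (Msg.ofList c (P.message₂ f v)) f = P.outA f v} + 8 * √(δ * (2 * c + 1)) := by
  classical
  set pA := P.coinsA.map (P.behaviorA c) with hpA
  set pB := P.coinsB.map (P.behaviorB c) with hpB
  have hA : ∀ x : pA.support, ∃ a ∈ P.coinsA.support, P.behaviorA c a = x := fun x => by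
    simpa [hpA] using x.2
  have hB : ∀ y : pB.support, ∃ b ∈ P.coinsB.support, P.behaviorB c b = y := fun y => by
    simpa [hpB] using y.2
  have hsum : ∀ {Ω : Type} [Fintype Ω] (p : PMF Ω), ∑ x : p.support, (p x).toReal = 1 := by
    intro Ω _ p
    simpa [sum_toReal] using sum_support p fun _ => 1
  have hmapf : ∀ (L : List (Bits n)) (f f' : Bits n → Bits n),
      (∀ x ∈ (L.toFinset : Set (Bits n)), f x = f' x) → L.map f = L.map f' := fun L f f' h =>
    List.map_congr_left fun x hx => h x (by simpa using hx)
  obtain ⟨H, Q, guess, hH, hQ, hQH, hg, hmain⟩ := exists_guess (D := Bits n) (R := Bits n)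
    (ι := pA.support) (κ := pB.support) (W₁ := Msg c) (W₂ := Msg c)
    (α := fun x => (pA x).toReal) (β := fun y => (pB y).toReal)
    (X := fun x => x.1.1) (Y := fun y => y.1.1) (M := fun x => x.1.2.1) (w := fun y => y.1.2)
    (out := fun x => x.1.2.2) (δ := δ) (L := 2 * c + 1) (l := l) hδ (by positivity)
    (fun _ => ENNReal.toReal_nonneg) (hsum pA) (fun _ => ENNReal.toReal_nonneg) (hsum pB)
    (fun x => by
      obtain ⟨a, ha, hax⟩ := hA x
      rw [← hax]
      exact (List.toFinset_card_le _).trans (hP.1 a ha))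
    (fun y => by
      obtain ⟨b, hb, hby⟩ := hB y
      rw [← hby]
      exact (List.toFinset_card_le _).trans (hP.2 b hb))
    (fun x => by
      obtain ⟨a, ha, hax⟩ := hA x
      rw [← hax]
      intro f f' h
      simp only [behaviorA]
      rw [hmapf _ f f' h])
    (fun y m => by
      obtain ⟨b, hb, hby⟩ := hB y
      rw [← hby]
      intro f f' h
      simp only [behaviorB]
      rw [hmapf _ f f' h])
    (fun x => by
      obtain ⟨a, ha, hax⟩ := hA x
      rw [← hax]
      intro f f' h
      simp only [behaviorA]
      rw [hmapf _ f f' h])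
    (by
      refine le_trans ?_ (card_msg_prod_bool_le c)
      rw [Fintype.card_prod, Fintype.card_bool]
      exact_mod_cast Nat.le_mul_of_pos_right _ two_pos)
    (card_msg_prod_bool_le c)
  refine ⟨H, Q, guess, hH, hQ, hQH, hg, ?_⟩
  have hm : ∀ f, ∀ v ∈ P.coins.support,
      (P.behaviorA c v.1).2.1 f = Msg.ofList c (P.message₁ f v) ∧
      ((P.behaviorB c v.2).2 ((P.behaviorA c v.1).2.1 f) f).1 = Msg.ofList c (P.message₂ f v) ∧
      (P.behaviorA c v.1).2.2 f
        ((P.behaviorB c v.2).2 ((P.behaviorA c v.1).2.1 f) f).1 = P.outA f v ∧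
      ((P.behaviorB c v.2).2 ((P.behaviorA c v.1).2.1 f) f).2 = P.outB f v := by
    intro f v hv
    have h := hc f v hv
    have e1 : (Msg.ofList c (P.message₁ f v) : List Bool) = P.message₁ f v :=
      Msg.coe_ofList (by omega)
    have e2 : (Msg.ofList c (P.message₂ f v) : List Bool) = P.message₂ f v :=
      Msg.coe_ofList (by omega)
    have e3 : (P.behaviorA c v.1).2.1 f = Msg.ofList c (P.message₁ f v) := rfl
    have e4 : ((P.behaviorB c v.2).2 ((P.behaviorA c v.1).2.1 f) f).1 =
        Msg.ofList c (P.message₂ f v) := by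
      rw [e3]
      simp only [behaviorB, e1]
      rfl
    refine ⟨e3, e4, ?_, ?_⟩
    · rw [e4]
      simp only [behaviorA, e2]
      rfl
    · rw [e3]
      simp only [behaviorB, e1]
      rfl
  have hl : ∀ f, prob P.coins {v | P.outA f v = P.outB f v} =
      prob P.coins {v | (fun (x : BehaviorA n c) (y : BehaviorB n c) =>
        x.2.2 f (y.2 (x.2.1 f) f).1 = (y.2 (x.2.1 f) f).2)
          (P.behaviorA c v.1) (P.behaviorB c v.2)} := fun f =>
    prob_congr _ fun v hv => by
      obtain ⟨-, -, h3, h4⟩ := hm f v hv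
      simp only [Set.mem_ofPred_eq, h3, h4]
  have hr : ∀ f, prob P.coins {v | guess (Msg.ofList c (P.message₁ f v))
        (Msg.ofList c (P.message₂ f v)) f = P.outA f v} =
      prob P.coins {v | (fun (x : BehaviorA n c) (y : BehaviorB n c) =>
        guess (x.2.1 f) (y.2 (x.2.1 f) f).1 f = x.2.2 f (y.2 (x.2.1 f) f).1)
          (P.behaviorA c v.1) (P.behaviorB c v.2)} := fun f =>
    prob_congr _ fun v hv => by
      obtain ⟨h1, h2, h3, -⟩ := hm f v hv
      simp only [Set.mem_ofPred_eq, h3]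
      simp only [h2]
      rw [h1]
  simp only [hl, hr]
  simp only [fun f => P.prob_coins_behavior c fun x y =>
      x.2.2 f (y.2 (x.2.1 f) f).1 = (y.2 (x.2.1 f) f).2,
    fun f => P.prob_coins_behavior c fun x y =>
      guess (x.2.1 f) (y.2 (x.2.1 f) f).1 f = x.2.2 f (y.2 (x.2.1 f) f).1]
  simp only [expect_sum_comm, ← mul_expect]
  exact hmain

theorem prob_guessExperiment_pure (e : List Bool × List Bool → OracleAlg (Bits n) (Bits n) Bool) :
    prob (P.guessExperiment fun t => PMF.pure (e t)) {p | p.1 = p.2} =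
      𝔼 f, prob P.coins {v | (e (P.trans f v)).run f = P.outA f v} := by
  rw [guessExperiment, prob_bind, Fintype.expect_eq_sum_div_card, sum_div]
  refine sum_congr rfl fun f _ => ?_
  simp only [PMF.pure_map]
  change _ * prob (P.coins.map fun v => ((e (P.trans f v)).run f, P.outA f v)) _ = _
  rw [prob_map, PMF.uniformOfFintype_apply, ENNReal.toReal_inv, ENNReal.toReal_natCast, mul_comm,
    div_eq_mul_inv]
  rfl

/-- The security loss against an eavesdropper that asks `q` queries. -/
theorem one_sub_le_of_isKeyAgreement {l q : ℕ} {α γ : ℝ} (hl : 1 ≤ l) (hq : 0 < q)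
    (hP : P.IsQueryBounded l) (hKA : P.IsKeyAgreement q α γ)
    (hc : ∀ f, ∀ v ∈ P.coins.support, (P.message₁ f v).length + (P.message₂ f v).length ≤ c) :
    1 - α ≤ γ + 8 * √(2 * l / q * (2 * c + 1)) := by
  have hl' : (0 : ℝ) < l := by exact_mod_cast hl
  have hq' : (0 : ℝ) < q := by exact_mod_cast hq
  -- This `δ` gives each of the two query sets at most `q / 2` elements.
  obtain ⟨H, Q, guess, hH, hQ, hQH, hg, hmain⟩ :=
    P.exists_guess_of_commComplexity c (δ := 2 * l / q) (by positivity) hP hc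
  have hcard : ∀ s : Finset (Bits n), s.card * (2 * l / q : ℝ) ≤ l → 2 * s.card ≤ q := by
    intro s hs
    rw [mul_div_assoc', div_le_iff₀ hq'] at hs
    have : (2 * s.card : ℝ) ≤ q := by
      refine le_of_mul_le_mul_right ?_ hl'
      linarith
    exact_mod_cast this
  have h2 : ∀ (m k : Msg c) (h : Bits n → Bits n),
      ∃ e : OracleAlg (Bits n) (Bits n) Bool, e.QueriesAtMost (q / 2) ∧
        ∀ f, e.run f = guess m k ((Q m h).piecewise f h) := by
    intro m k h
    obtain ⟨e, he, hrun⟩ := OracleAlg.exists_query_finset (Q m h) h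
      (fun f => OracleAlg.output (D := Bits n) (R := Bits n) (guess m k f)) (q := 0)
      fun _ => trivial
    have := hcard _ (hQ m h)
    exact ⟨e, he.mono (by omega), hrun⟩
  choose e₂ he₂ hrun₂ using h2
  have h1 : ∀ m k : Msg c, ∃ e : OracleAlg (Bits n) (Bits n) Bool, e.QueriesAtMost q ∧
      ∀ f, e.run f = guess m k f := by
    intro m k
    -- `H` comes first because its answers determine `Q`. The filler `id` for unasked points is
    -- arbitrary: the guess reads only `H ∪ Q`.
    obtain ⟨e, he, hrun⟩ := OracleAlg.exists_query_finset H id (e₂ m k) (he₂ m k)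
    have := hcard _ hH
    refine ⟨e, he.mono (by omega), fun f => ?_⟩
    have hQf : Q m (H.piecewise f id) = Q m f :=
      hQH m fun x hx => piecewise_eq_of_mem _ _ _ hx
    rw [hrun, hrun₂, hQf, ← hg m k f id]
    congr 1
    funext x
    by_cases hx : x ∈ Q m f <;> by_cases hxH : x ∈ H <;> simp [hx, hxH]
  choose e he hrun using h1
  have hsec := hKA.2
    (fun t => PMF.pure (e (Msg.ofList c t.1) (Msg.ofList c t.2))) fun t e' he' => by
      rw [PMF.support_pure, Set.mem_singleton_iff] at he'
      rw [he']
      exact he _ _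
  rw [prob_guessExperiment_pure P fun t => e (Msg.ofList c t.1) (Msg.ofList c t.2)] at hsec
  simp only [hrun] at hsec
  have hacc : 1 - α ≤ 𝔼 f, prob P.coins {v | P.outA f v = P.outB f v} :=
    le_expect univ_nonempty fun f _ => hKA.1 f
  exact hacc.trans (hmain.trans (add_le_add_left hsec _))

end TwoMessageProtocol

theorem mainTheorem1 (n l q : ℕ) (α γ : ℝ) (hl : 1 ≤ l)
    (hα : 0 ≤ α) (hγ : 0 ≤ γ) (hαγ : α + γ ≤ 1)
    (P : TwoMessageProtocol n) (hP : P.IsQueryBounded l) (hKA : P.IsKeyAgreement q α γ) :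
    (((1 - α - γ) ^ 2 * (q : ℝ) / (50 ^ 2 * (l : ℝ)) - 6 : ℝ) : EReal) ≤
      ((P.commComplexity : ENNReal) : EReal) := by
  cases hcc : P.commComplexity with
  | top => simp
  | coe c =>
    have hc : ∀ f, ∀ v ∈ P.coins.support,
        (P.message₁ f v).length + (P.message₂ f v).length ≤ c := by
      intro f v hv
      have : (((P.message₁ f v).length + (P.message₂ f v).length : ℕ) : ℕ∞) ≤ c := by
        rw [← hcc]
        exact le_iSup_of_le f (le_iSup₂_of_le v hv le_rfl)
      exact_mod_cast this
    have hl' : (0 : ℝ) < l := by exact_mod_cast hl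
    have hc0 : (0 : ℝ) ≤ c := Nat.cast_nonneg c
    suffices h : (1 - α - γ) ^ 2 * (q : ℝ) / (50 ^ 2 * (l : ℝ)) - 6 ≤ (c : ℝ) by
      have h' : (((1 - α - γ) ^ 2 * (q : ℝ) / (50 ^ 2 * (l : ℝ)) - 6 : ℝ) : EReal) ≤
        ((c : ℝ) : EReal) := EReal.coe_le_coe_iff.2 h
      refine h'.trans_eq ?_
      rw [ENat.toENNReal_coe, ← ENNReal.ofReal_natCast, EReal.coe_ennreal_ofReal,
        max_eq_left hc0]
    -- The choice `δ = 2ℓ/q` needs `q > 0`; for `q = 0` the bound is negative.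
    rcases Nat.eq_zero_or_pos q with rfl | hq
    · simp; linarith
    have hq' : (0 : ℝ) < q := by exact_mod_cast hq
    have hmain := P.one_sub_le_of_isKeyAgreement c hl hq hP hKA hc
    have hsq : (1 - α - γ) ^ 2 ≤ 64 * (2 * l / q * (2 * c + 1)) := by
      have h0 : (0 : ℝ) ≤ 2 * l / q * (2 * c + 1) := by positivity
      calc (1 - α - γ) ^ 2 ≤ (8 * √(2 * l / q * (2 * c + 1))) ^ 2 :=
            pow_le_pow_left₀ (by linarith) (by linarith) 2
        _ = _ := by rw [mul_pow, Real.sq_sqrt h0]; norm_num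
    have hmul : (1 - α - γ) ^ 2 * q ≤ 128 * (2 * c + 1) * l := by
      calc (1 - α - γ) ^ 2 * q ≤ 64 * (2 * l / q * (2 * c + 1)) * q := by gcongr
        _ = _ := by field_simp; ring
    -- It remains that `128(2c + 1) ≤ 2500(c + 6)`, which leaves ample room.
    rw [sub_le_iff_le_add, div_le_iff₀ (by positivity)]
    nlinarith [mul_nonneg hc0 hl'.le]
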